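/- Let $\Omega\subset\mathbb R^n$ be open (for instance a regular bounded polyhedral domain), let $d\ge 0$ be an integer, and let $\|\cdot\|$ denote the norm of $L^2(\Omega)^d$. Let $\delta>0$, and let $G:L^2(\Omega)^d\to L^2(\Omega)^d$ be the Helmholtz filter: $Gf$ is the unique $w\in H^1_0(\Omega)^d$ with $-\delta^2\Delta w+w=f$ in the weak sense, that is, $\delta^2(\nabla w,\nabla v)+(w,v)=(f,v)$ for all $v\in H^1_0(\Omega)^d$. Let $\alpha>0$ and let $J\ge 0$ be an integer. Let $u,\bar u,\epsilon\in L^2(\Omega)^d$ satisfy $Gu=\bar u+\epsilon$ and $\|\epsilon\|<\epsilon_0$. Assume that the weak Laplacians $\Delta u,\dots,\Delta^{J+1}u$ exist in $L^2(\Omega)^d$ and that $u,\Delta u,\dots,\Delta^{J}u\in H^1_0(\Omega)^d$ (homogeneous boundary data). Then $(1-\alpha)G+\alpha I$ is boundedly invertible on $L^2(\Omega)^d$. Put $D_\alpha=[(1-\alpha)G+\alpha I]^{-1}$. Let $u_0,\dots,u_J$ be the Mitlar (modified iterated Tikhonov–Lavrentiev) iterates, given by $$[(1-\alpha)G+\alpha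 I]u_0=\bar u,\qquad [(1-\alpha)G+\alpha I](u_j-u_{j-1})=\bar u-Gu_{j-1}\quad(1\le j\le J).$$ Then the error $e_J=u-u_J$ satisfies $$e_J=(-\alpha\delta^2)^{J+1}(D_\alpha G)^{J+1}\Delta^{J+1}u+D_\alpha\sum_{j=0}^{J}(I-D_\alpha G)^j\epsilon .$$ If moreover $\alpha\le 1$, then $$\|e_J\|\le(\alpha\delta^2)^{J+1}\|\Delta^{J+1}u\|+\frac{(J+1)\epsilon_0}{\alpha}.$$ -/

import Mathlib

open MeasureTheory Topology Filter Set
open scoped ContDiff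

noncomputable section

namespace Mitlar

/-- The Hilbert space `L²(Ω)^d` of square integrable `ℝ^d`-valued functions on `Ω ⊆ ℝⁿ`. -/
abbrev L2 {n : ℕ} (Ω : Set (EuclideanSpace ℝ (Fin n))) (d : ℕ) : Type :=
  Lp (EuclideanSpace ℝ (Fin d)) 2 (volume.restrict Ω)

/-- The classical partial derivative `∂ᵢ φ`. -/
def pderiv {n : ℕ} {F : Type*} [NormedAddCommGroup F] [NormedSpace ℝ F] (i : Fin n)
    (φ : EuclideanSpace ℝ (Fin n) → F) : EuclideanSpace ℝ (Fin n) → F :=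
  fun x => fderiv ℝ φ x (EuclideanSpace.single i 1)

/-- `φ ∈ C_c^∞(Ω; F)`, extended by zero to `ℝⁿ`. -/
structure IsTest {n : ℕ} {F : Type*} [NormedAddCommGroup F] [NormedSpace ℝ F]
    (Ω : Set (EuclideanSpace ℝ (Fin n))) (φ : EuclideanSpace ℝ (Fin n) → F) : Prop where
  smooth : ContDiff ℝ ∞ φ
  compact : HasCompactSupport φ
  support : tsupport φ ⊆ Ω

/-- `g = (g₁, …, gₙ)` is the weak gradient of `v` on `Ω`:
`∫_Ω (∂ᵢ φ) v = - ∫_Ω φ gᵢ` for every scalar test function `φ` and every `i`. -/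
def IsWeakGrad {n d : ℕ} (Ω : Set (EuclideanSpace ℝ (Fin n))) (v : L2 Ω d)
    (g : Fin n → L2 Ω d) : Prop :=
  ∀ φ : EuclideanSpace ℝ (Fin n) → ℝ, IsTest Ω φ → ∀ i : Fin n,
    ∫ x in Ω, pderiv i φ x • v x = - ∫ x in Ω, φ x • g i x

/-- `w` is the weak (distributional) Laplacian of `v` on `Ω`:
`∫_Ω (Δ φ) v = ∫_Ω φ w` for every scalar test function `φ`. -/
def IsWeakLaplacian {n d : ℕ} (Ω : Set (EuclideanSpace ℝ (Fin n))) (v w : L2 Ω d) : Prop :=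
  ∀ φ : EuclideanSpace ℝ (Fin n) → ℝ, IsTest Ω φ →
    ∫ x in Ω, (∑ i, pderiv i (pderiv i φ) x) • v x = ∫ x in Ω, φ x • w x

/-- The pairs `(φ, ∇φ)`, `φ ∈ C_c^∞(Ω; ℝ^d)`, as elements of `L² × (L²)ⁿ`. -/
def testGraph {n : ℕ} (Ω : Set (EuclideanSpace ℝ (Fin n))) (d : ℕ) :
    Set (L2 Ω d × (Fin n → L2 Ω d)) :=
  {p | ∃ φ : EuclideanSpace ℝ (Fin n) → EuclideanSpace ℝ (Fin d), IsTest Ω φ ∧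
    p.1 =ᵐ[volume.restrict Ω] φ ∧ ∀ i, p.2 i =ᵐ[volume.restrict Ω] pderiv i φ}

/-- `v ∈ H¹₀(Ω)^d`: `v` has a weak gradient in `L²` and is a limit, in the `H¹` topology,
of functions in `C_c^∞(Ω; ℝ^d)`. -/
def MemH10 {n d : ℕ} (Ω : Set (EuclideanSpace ℝ (Fin n))) (v : L2 Ω d) : Prop :=
  ∃ g : Fin n → L2 Ω d, IsWeakGrad Ω v g ∧ (v, g) ∈ closure (testGraph Ω d)

/-- `w` is the Helmholtz-filtered `f`: `w ∈ H¹₀(Ω)^d` and `-δ² Δ w + w = f` weakly, i.e.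
`δ² (∇w, ∇v) + (w, v) = (f, v)` for every `v ∈ H¹₀(Ω)^d`. -/
def IsFiltered {n d : ℕ} (Ω : Set (EuclideanSpace ℝ (Fin n))) (δ : ℝ) (f w : L2 Ω d) : Prop :=
  MemH10 Ω w ∧ ∃ g : Fin n → L2 Ω d, IsWeakGrad Ω w g ∧
    ∀ (v : L2 Ω d) (h : Fin n → L2 Ω d), MemH10 Ω v → IsWeakGrad Ω v h →
      δ ^ 2 * ∑ i, inner ℝ (g i) (h i) + inner ℝ w v = inner ℝ f v

section Aux

variable {n d : ℕ} {Ω : Set (EuclideanSpace ℝ (Fin n))}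

theorem IsTest.pderiv {F : Type*} [NormedAddCommGroup F] [NormedSpace ℝ F]
    {φ : EuclideanSpace ℝ (Fin n) → F} (hφ : IsTest Ω φ) (i : Fin n) :
    IsTest Ω (pderiv i φ) := by
  have hsub : tsupport (Mitlar.pderiv i φ) ⊆ tsupport φ :=
    closure_minimal (fun x hx => by
      by_contra hx'
      have h0 : fderiv ℝ φ x = 0 := by
        by_contra h1
        exact hx' (support_fderiv_subset ℝ (f := φ) h1)
      exact hx (by simp [Mitlar.pderiv, h0])) (isClosed_tsupport _)
  refine ⟨?_, ?_, hsub.trans hφ.support⟩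
  · exact (hφ.smooth.fderiv_right (m := ∞) (by simp)).clm_apply contDiff_const
  · exact IsCompact.of_isClosed_subset hφ.compact (isClosed_tsupport _) hsub

theorem IsTest.memLp {F : Type*} [NormedAddCommGroup F] [NormedSpace ℝ F]
    {φ : EuclideanSpace ℝ (Fin n) → F} (hφ : IsTest Ω φ) :
    MemLp φ 2 (volume.restrict Ω) :=
  (hφ.smooth.continuous.memLp_of_hasCompactSupport (μ := volume) hφ.compact).restrict Ω

theorem IsTest.integrable_smul {ψ : EuclideanSpace ℝ (Fin n) → ℝ} (hψ : IsTest Ω ψ)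
    (v : L2 Ω d) : Integrable (fun x => ψ x • v x) (volume.restrict Ω) := by
  have h := MemLp.smul (p := 2) (q := 2) (r := 1) (Lp.memLp v) hψ.memLp
  exact memLp_one_iff_integrable.1 h

/-- Pairing with a scalar test function is continuous on `L²`. -/
theorem continuous_pair {ψ : EuclideanSpace ℝ (Fin n) → ℝ} (hψ : IsTest Ω ψ) :
    Continuous (fun v : L2 Ω d => ∫ x in Ω, ψ x • v x) := by
  have hlip : ∀ v w : L2 Ω d,
      ∫ x in Ω, ψ x • (v + w : L2 Ω d) x = (∫ x in Ω, ψ x • v x) + ∫ x in Ω, ψ x • w x := by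
    intro v w
    rw [← integral_add (hψ.integrable_smul v) (hψ.integrable_smul w)]
    refine integral_congr_ae ?_
    filter_upwards [Lp.coeFn_add v w] with x hx
    rw [hx, Pi.add_apply, smul_add]
  have hsm : ∀ (c : ℝ) (v : L2 Ω d),
      ∫ x in Ω, ψ x • (c • v : L2 Ω d) x = c • ∫ x in Ω, ψ x • v x := by
    intro c v
    rw [← integral_smul]
    refine integral_congr_ae ?_
    filter_upwards [Lp.coeFn_smul c v] with x hx
    rw [hx, Pi.smul_apply, smul_comm]
  let T : L2 Ω d →ₗ[ℝ] EuclideanSpace ℝ (Fin d) :=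
    { toFun := fun v => ∫ x in Ω, ψ x • v x, map_add' := hlip, map_smul' := hsm }
  have key : ∀ (c : EuclideanSpace ℝ (Fin d)), Continuous (fun v => inner ℝ c (T v)) := by
    intro c
    have hc : MemLp (fun x => ψ x • c) 2 (volume.restrict Ω) := by
      have := hψ.memLp
      refine MemLp.of_le_mul (c := ‖c‖) this
        (this.aestronglyMeasurable.smul_const c) (Eventually.of_forall fun x => ?_)
      rw [norm_smul, mul_comm]
    have : (fun v => inner ℝ c (T v)) = fun v : L2 Ω d => inner ℝ (hc.toLp _) v := by
      funext v
      rw [L2.inner_def]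
      change inner ℝ c (∫ x in Ω, ψ x • v x) = _
      rw [← integral_inner (hψ.integrable_smul v)]
      refine integral_congr_ae ?_
      filter_upwards [hc.coeFn_toLp] with x hx
      rw [hx, real_inner_smul_left, real_inner_smul_right]
    rw [this]
    fun_prop
  have : Continuous (fun v => (T v)) := by
    refine (PiLp.continuous_toLp 2 _).comp (f := fun v => fun i => T v i) ?_
    refine continuous_pi fun i => ?_
    have := key (EuclideanSpace.single i 1)
    simpa [EuclideanSpace.inner_single_left] using this
  exact this

theorem testGraph_isWeakGrad {p : L2 Ω d × (Fin n → L2 Ω d)} (hp : p ∈ testGraph Ω d) :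
    IsWeakGrad Ω p.1 p.2 := by
  obtain ⟨φ, hφ, h1, h2⟩ := hp
  intro ψ hψ i
  have e1 : ∫ x in Ω, pderiv i ψ x • p.1 x = ∫ x in Ω, pderiv i ψ x • φ x := by
    refine integral_congr_ae ?_
    filter_upwards [h1] with x hx
    rw [hx]
  have e2 : ∫ x in Ω, ψ x • p.2 i x = ∫ x in Ω, ψ x • pderiv i φ x := by
    refine integral_congr_ae ?_
    filter_upwards [h2 i] with x hx
    rw [hx]
  have s0 : ∀ x, x ∉ Ω → φ x = 0 := fun x hx =>
    image_eq_zero_of_notMem_tsupport fun h => hx (hφ.support h)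
  have s1 : ∀ x, x ∉ Ω → ψ x = 0 := fun x hx =>
    image_eq_zero_of_notMem_tsupport fun h => hx (hψ.support h)
  rw [e1, e2, setIntegral_eq_integral_of_forall_compl_eq_zero,
    setIntegral_eq_integral_of_forall_compl_eq_zero]
  · have hi : ∀ (a : EuclideanSpace ℝ (Fin n) → ℝ)
        (b : EuclideanSpace ℝ (Fin n) → EuclideanSpace ℝ (Fin d)),
        IsTest Ω a → IsTest Ω b → Integrable (fun x => a x • b x) volume := by
      intro a b ha hb
      refine (ha.smooth.continuous.smul hb.smooth.continuous).integrable_of_hasCompactSupport ?_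
      exact ha.compact.smul_right
    have := integral_smul_fderiv_eq_neg_fderiv_smul_of_integrable (μ := volume) (f := ψ) (g := φ)
      (v := EuclideanSpace.single i (1 : ℝ)) (hi _ _ (hψ.pderiv i) hφ) (hi _ _ hψ (hφ.pderiv i))
      (hi _ _ hψ hφ) (fun x _ => (hψ.smooth.differentiable (by simp)) x)
      (fun x _ => (hφ.smooth.differentiable (by simp)) x)
    change _ = -∫ x, ψ x • fderiv ℝ φ x (EuclideanSpace.single i 1)
    rw [this, neg_neg]
    rfl
  · intro x hx
    rw [s1 x hx, zero_smul]
  · intro x hx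
    rw [s0 x hx, smul_zero]

theorem closure_isWeakGrad {v : L2 Ω d} {g : Fin n → L2 Ω d}
    (h : (v, g) ∈ closure (testGraph Ω d)) : IsWeakGrad Ω v g := by
  have hcl : IsClosed {p : L2 Ω d × (Fin n → L2 Ω d) | IsWeakGrad Ω p.1 p.2} := by
    simp only [IsWeakGrad, ofPred_forall]
    refine isClosed_iInter fun φ => isClosed_iInter fun hφ => isClosed_iInter fun i => ?_
    refine isClosed_eq ((continuous_pair (hφ.pderiv i)).comp continuous_fst) ?_
    exact ((continuous_pair hφ).comp ((continuous_apply i).comp continuous_snd)).neg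
  exact closure_minimal (fun p hp => testGraph_isWeakGrad hp) hcl h

theorem IsWeakGrad.unique (hΩ : IsOpen Ω) {v : L2 Ω d} {g h : Fin n → L2 Ω d}
    (hg : IsWeakGrad Ω v g) (hh : IsWeakGrad Ω v h) : g = h := by
  funext i
  have hz : ∀ᵐ x ∂(volume.restrict Ω), x ∈ Ω → (g i - h i : L2 Ω d) x = 0 := by
    refine hΩ.ae_eq_zero_of_integral_contDiff_smul_eq_zero
      (((Lp.memLp (g i - h i)).locallyIntegrable (by norm_num)).locallyIntegrableOn Ω) ?_
    intro φ h1 h2 h3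
    have hφ : IsTest Ω φ := ⟨h1, h2, h3⟩
    have e : ∫ x in Ω, φ x • (g i - h i : L2 Ω d) x
        = (∫ x in Ω, φ x • g i x) - ∫ x in Ω, φ x • h i x := by
      rw [← integral_sub (hφ.integrable_smul _) (hφ.integrable_smul _)]
      refine integral_congr_ae ?_
      filter_upwards [Lp.coeFn_sub (g i) (h i)] with x hx
      rw [hx, Pi.sub_apply, smul_sub]
    rw [e, sub_eq_zero]
    exact neg_injective ((hg φ hφ i).symm.trans (hh φ hφ i))
  rw [← sub_eq_zero]
  refine (Lp.eq_zero_iff_ae_eq_zero).2 ?_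
  filter_upwards [hz, ae_restrict_mem hΩ.measurableSet] with x hx hm
  exact hx hm

/-- `L² × (L²)ⁿ` with its Hilbert space structure. -/
abbrev PairSpace (Ω : Set (EuclideanSpace ℝ (Fin n))) (d : ℕ) : Type :=
  WithLp 2 (L2 Ω d × PiLp 2 (fun _ : Fin n => L2 Ω d))

/-- The pair `(v, δ g)` as an element of the Hilbert space `PairSpace`. -/
def toPair (δ : ℝ) (p : L2 Ω d × (Fin n → L2 Ω d)) : PairSpace Ω d :=
  WithLp.toLp 2 (p.1, WithLp.toLp 2 (δ • p.2))

theorem continuous_toPair (δ : ℝ) : Continuous (toPair (Ω := Ω) (d := d) δ) := by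
  unfold toPair
  fun_prop

theorem inner_toPair (δ : ℝ) (p q : L2 Ω d × (Fin n → L2 Ω d)) :
    inner ℝ (toPair δ p) (toPair δ q)
      = δ ^ 2 * ∑ i, inner ℝ (p.2 i) (q.2 i) + inner ℝ p.1 q.1 := by
  simp only [toPair, WithLp.prod_inner_apply, PiLp.inner_apply, Pi.smul_apply,
    real_inner_smul_left, real_inner_smul_right, Finset.mul_sum]
  rw [add_comm]
  congr 1
  exact Finset.sum_congr rfl fun i _ => by ring

theorem testGraph_add {p q : L2 Ω d × (Fin n → L2 Ω d)} (hp : p ∈ testGraph Ω d)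
    (hq : q ∈ testGraph Ω d) : p + q ∈ testGraph Ω d := by
  obtain ⟨φ, hφ, h1, h2⟩ := hp
  obtain ⟨ψ, hψ, k1, k2⟩ := hq
  refine ⟨φ + ψ, ⟨hφ.smooth.add hψ.smooth, hφ.compact.add hψ.compact, ?_⟩, ?_, fun i => ?_⟩
  · exact (tsupport_add φ ψ).trans (union_subset hφ.support hψ.support)
  · filter_upwards [Lp.coeFn_add p.1 q.1, h1, k1] with x hx a b
    simp only [Prod.fst_add, hx, Pi.add_apply, a, b]
  · filter_upwards [Lp.coeFn_add (p.2 i) (q.2 i), h2 i, k2 i] with x hx a b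
    simp only [Prod.snd_add, Pi.add_apply, hx, a, b, pderiv]
    rw [fderiv_add ((hφ.smooth.differentiable (by simp)) x)
      ((hψ.smooth.differentiable (by simp)) x)]
    rfl

theorem testGraph_smul (c : ℝ) {p : L2 Ω d × (Fin n → L2 Ω d)} (hp : p ∈ testGraph Ω d) :
    c • p ∈ testGraph Ω d := by
  obtain ⟨φ, hφ, h1, h2⟩ := hp
  refine ⟨c • φ, ⟨hφ.smooth.const_smul c, ?_, ?_⟩, ?_, fun i => ?_⟩
  · exact hφ.compact.smul_left (f := fun _ => c)
  · exact (tsupport_smul_subset_right (fun _ => c) φ).trans hφ.support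
  · filter_upwards [Lp.coeFn_smul c p.1, h1] with x hx a
    simp only [Prod.smul_fst, hx, Pi.smul_apply, a]
  · filter_upwards [Lp.coeFn_smul c (p.2 i), h2 i] with x hx a
    simp only [Prod.smul_snd, Pi.smul_apply, hx, a, pderiv]
    rw [fderiv_const_smul ((hφ.smooth.differentiable (by simp)) x)]
    rfl

theorem testGraph_zero : (0 : L2 Ω d × (Fin n → L2 Ω d)) ∈ testGraph Ω d := by
  refine ⟨0, ⟨contDiff_const, HasCompactSupport.zero, ?_⟩, ?_, fun i => ?_⟩
  · simp [tsupport]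
  · exact Lp.coeFn_zero _ _ _
  · filter_upwards [Lp.coeFn_zero (EuclideanSpace ℝ (Fin d)) 2 (volume.restrict Ω)] with x hx
    simpa [pderiv] using hx

/-- The subspace of all `(φ, δ ∇φ)` with `φ` a test function. -/
def testSubmodule (Ω : Set (EuclideanSpace ℝ (Fin n))) (d : ℕ) (δ : ℝ) :
    Submodule ℝ (PairSpace Ω d) where
  carrier := toPair δ '' testGraph Ω d
  zero_mem' := ⟨0, testGraph_zero, by simp [toPair]⟩
  add_mem' := by
    rintro _ _ ⟨p, hp, rfl⟩ ⟨q, hq, rfl⟩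
    exact ⟨p + q, testGraph_add hp hq, by simp [toPair, smul_add]; rfl⟩
  smul_mem' := by
    rintro c _ ⟨p, hp, rfl⟩
    exact ⟨c • p, testGraph_smul c hp, by
      simp only [toPair, Prod.smul_fst, Prod.smul_snd, smul_comm δ c]
      rfl⟩

theorem IsFiltered.unique {δ : ℝ} {f w₁ w₂ : L2 Ω d} (h₁ : IsFiltered Ω δ f w₁)
    (h₂ : IsFiltered Ω δ f w₂) : w₁ = w₂ := by
  obtain ⟨m₁, g₁, k₁, e₁⟩ := h₁
  obtain ⟨m₂, g₂, k₂, e₂⟩ := h₂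
  have a := e₁ _ _ m₁ k₁
  have b := e₁ _ _ m₂ k₂
  have c := e₂ _ _ m₁ k₁
  have e := e₂ _ _ m₂ k₂
  have key : δ ^ 2 * ∑ i, inner ℝ (g₁ i - g₂ i) (g₁ i - g₂ i)
      + inner ℝ (w₁ - w₂) (w₁ - w₂) = 0 := by
    simp only [inner_sub_left, inner_sub_right, Finset.sum_sub_distrib]
    linarith
  have p1 : 0 ≤ δ ^ 2 * ∑ i, inner ℝ (g₁ i - g₂ i) (g₁ i - g₂ i) :=
    mul_nonneg (sq_nonneg δ) (Finset.sum_nonneg fun i _ => real_inner_self_nonneg)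
  have p2 : inner ℝ (w₁ - w₂) (w₁ - w₂) = 0 :=
    le_antisymm (by linarith) real_inner_self_nonneg
  exact sub_eq_zero.1 (inner_self_eq_zero.1 p2)

/-- The Helmholtz problem is well posed. -/
theorem existsUnique_filter (hΩ : IsOpen Ω) {δ : ℝ} (hδ : 0 < δ) :
    ∃! G : L2 Ω d →L[ℝ] L2 Ω d, ∀ f, IsFiltered Ω δ f (G f) := by
  let V := (testSubmodule Ω d δ).topologicalClosure
  let e := WithLp.prodContinuousLinearEquiv 2 ℝ (L2 Ω d) (PiLp 2 (fun _ : Fin n => L2 Ω d))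
  let G : L2 Ω d →L[ℝ] L2 Ω d :=
    (ContinuousLinearMap.fst ℝ (L2 Ω d) (PiLp 2 (fun _ : Fin n => L2 Ω d))).comp
      ((e : PairSpace Ω d →L[ℝ] _).comp (V.starProjection.comp
        ((e.symm : _ →L[ℝ] PairSpace Ω d).comp
          (ContinuousLinearMap.inl ℝ (L2 Ω d) (PiLp 2 (fun _ : Fin n => L2 Ω d))))))
  have hG : ∀ f, IsFiltered Ω δ f (G f) := by
    intro f
    set y : PairSpace Ω d := V.starProjection (e.symm (f, 0)) with hy
    have hyV : y ∈ V := V.starProjection_apply_mem _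
    have hGf : G f = y.fst := rfl
    let q : PairSpace Ω d → L2 Ω d × (Fin n → L2 Ω d) := fun z => (z.fst, δ⁻¹ • z.snd.ofLp)
    have hqc : Continuous q := by fun_prop
    have hq1 : ∀ p, q (toPair δ p) = p := by
      intro p
      change (p.1, δ⁻¹ • δ • p.2) = p
      rw [smul_smul, inv_mul_cancel₀ hδ.ne', one_smul]
    have hq2 : toPair δ (q y) = y := by
      simp only [q, toPair, smul_smul, mul_inv_cancel₀ hδ.ne', one_smul]
      rfl
    have hmem : q y ∈ closure (testGraph Ω d) := by
      refine map_mem_closure hqc (s := (testSubmodule Ω d δ : Set (PairSpace Ω d))) hyV ?_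
      rintro _ ⟨p, hp, rfl⟩
      rw [hq1]
      exact hp
    have hwg : IsWeakGrad Ω (G f) (q y).2 := closure_isWeakGrad hmem
    refine ⟨⟨(q y).2, hwg, hmem⟩, (q y).2, hwg, ?_⟩
    rintro v h ⟨h', hh', hcl⟩ hh
    obtain rfl : h = h' := hh.unique hΩ hh'
    have hvV : toPair δ (v, h) ∈ V := by
      have hm : toPair δ (v, h) ∈ closure (testSubmodule Ω d δ : Set (PairSpace Ω d)) :=
        map_mem_closure (continuous_toPair δ) hcl fun p hp => ⟨p, hp, rfl⟩
      exact hm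
    have horth := V.starProjection_inner_eq_zero (e.symm (f, 0)) _ hvV
    rw [← hy, inner_sub_left, sub_eq_zero] at horth
    have h1 : inner ℝ (e.symm (f, 0)) (toPair δ (v, h)) = inner ℝ f v := by
      simp [e, toPair, WithLp.prod_inner_apply]
    rw [h1, ← hq2, inner_toPair] at horth
    exact horth.symm
  refine ⟨G, hG, fun G' hG' => ?_⟩
  ext1 f
  exact (hG' f).unique (hG f)

end Aux

/-- The Helmholtz (differential) filter `G` of radius `δ`, as an operator on `L²(Ω)^d`:
`G f` is the unique `w ∈ H¹₀(Ω)^d` with `-δ² Δ w + w = f` weakly. -/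
def helmholtzFilter {n : ℕ} {Ω : Set (EuclideanSpace ℝ (Fin n))} (hΩ : IsOpen Ω) (d : ℕ)
    {δ : ℝ} (hδ : 0 < δ) : L2 Ω d →L[ℝ] L2 Ω d :=
  (existsUnique_filter (d := d) hΩ hδ).choose

theorem helmholtzFilter_spec {n : ℕ} {Ω : Set (EuclideanSpace ℝ (Fin n))} (hΩ : IsOpen Ω) (d : ℕ)
    {δ : ℝ} (hδ : 0 < δ) (f : L2 Ω d) : IsFiltered Ω δ f (helmholtzFilter hΩ d hδ f) :=
  (existsUnique_filter (d := d) hΩ hδ).choose_spec.1 f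

/-- The operator `(1 - α) G + α I`. -/
def mitlarOp {n d : ℕ} {Ω : Set (EuclideanSpace ℝ (Fin n))} (α : ℝ)
    (G : L2 Ω d →L[ℝ] L2 Ω d) : L2 Ω d →L[ℝ] L2 Ω d :=
  (1 - α) • G + α • ContinuousLinearMap.id ℝ (L2 Ω d)

/-- `D_α = [(1 - α) G + α I]⁻¹` (the two-sided inverse in the ring of bounded operators, if the
operator is invertible there). -/
def regInv {n d : ℕ} {Ω : Set (EuclideanSpace ℝ (Fin n))} (α : ℝ)
    (G : L2 Ω d →L[ℝ] L2 Ω d) : L2 Ω d →L[ℝ] L2 Ω d :=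
  Ring.inverse (mitlarOp α G)

/-- `U 0, …, U J` are the iterates of the modified iterated Tikhonov-Lavrentiev algorithm for the
data `ubar`. -/
structure IsMitlar {n d : ℕ} {Ω : Set (EuclideanSpace ℝ (Fin n))} (α : ℝ)
    (G : L2 Ω d →L[ℝ] L2 Ω d) (J : ℕ) (ubar : L2 Ω d) (U : ℕ → L2 Ω d) : Prop where
  init : mitlarOp α G (U 0) = ubar
  step : ∀ j, 1 ≤ j → j ≤ J → mitlarOp α G (U j - U (j - 1)) = ubar - G (U (j - 1))

/-- `L 0 = u, L 1 = Δ u, …, L m = Δ^m u`, all in `L²(Ω)^d`, with homogeneous boundary data: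
`Δ^j u ∈ H¹₀(Ω)^d` for `j < m`. -/
structure IsLaplacianChain {n d : ℕ} (Ω : Set (EuclideanSpace ℝ (Fin n))) (u : L2 Ω d) (m : ℕ)
    (L : ℕ → L2 Ω d) : Prop where
  zero : L 0 = u
  memH10 : ∀ j < m, MemH10 Ω (L j)
  succ : ∀ j < m, IsWeakLaplacian Ω (L j) (L (j + 1))

end Mitlar

end

namespace Mitlar

/-! ### The filter as the inverse of `I - δ²Δ` on `H¹₀`. -/

section WeakLaplacian

variable {n d : ℕ} {Ω : Set (EuclideanSpace ℝ (Fin n))}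

/-! Write `A = (1-α)G + αI = G + α(I-G)` and `D = A⁻¹`. Two facts about the filter carry everything.
Firm nonexpansiveness: testing the weak equation with its own solution gives `‖Gx‖² ≤ (x, Gx)`.
Hence `A` is coercive, so invertible, and the two summands of `Ax` have nonnegative inner product,
so each is no longer than `Ax`. Taking `x = Dy`, and using that `D` commutes with `G`, makes `DG`
and `I-DG` contractions. Inversion of the Laplacian: on `H¹₀` functions with an `L²` Laplacian,
`(I-G)v = -δ²GΔv`. Since `I-DG = αD(I-G)`, each application of `I-DG` to such a function becomes
`-αδ² DG` applied to its Laplacian. The iteration gives `e_{j+1} = (I-DG)e_j + Dε`; unrolling it and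
trading all `J+1` factors yields the formula, and the contractions yield the bound. -/

theorem IsTest.coord {φ : EuclideanSpace ℝ (Fin n) → EuclideanSpace ℝ (Fin d)}
    (hφ : IsTest Ω φ) (k : Fin d) : IsTest Ω (fun x => φ x k) := by
  have hsub : tsupport (fun x => φ x k) ⊆ tsupport φ :=
    closure_mono fun x hx h0 => hx (by simp [h0])
  refine ⟨?_, IsCompact.of_isClosed_subset hφ.compact (isClosed_tsupport _) hsub,
    hsub.trans hφ.support⟩
  exact (EuclideanSpace.proj (𝕜 := ℝ) k).contDiff.comp hφ.smooth

theorem pderiv_coord {φ : EuclideanSpace ℝ (Fin n) → EuclideanSpace ℝ (Fin d)}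
    (hφ : IsTest Ω φ) (i : Fin n) (k : Fin d) :
    pderiv i (fun x => φ x k) = fun x => pderiv i φ x k := by
  funext x
  have h := (EuclideanSpace.proj (𝕜 := ℝ) k).hasFDerivAt.comp x
    (hφ.smooth.differentiable (by simp) x).hasFDerivAt
  change fderiv ℝ (fun x => φ x k) x _ = _
  rw [show (fun x => φ x k) = ⇑(EuclideanSpace.proj (𝕜 := ℝ) k) ∘ φ from rfl, h.fderiv]
  rfl

/-- The `L²` inner product with a vector-valued test function, in coordinates. -/
theorem inner_test_eq_sum {φ : EuclideanSpace ℝ (Fin n) → EuclideanSpace ℝ (Fin d)}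
    (hφ : IsTest Ω φ) {f : L2 Ω d} (hf : f =ᵐ[volume.restrict Ω] φ) (v : L2 Ω d) :
    inner ℝ v f = ∑ k, (∫ x in Ω, φ x k • v x) k := by
  have hk : ∀ k, (∫ x in Ω, φ x k • v x) k = ∫ x in Ω, φ x k * v x k := fun k =>
    ((EuclideanSpace.proj (𝕜 := ℝ) k).integral_comp_comm
      ((hφ.coord k).integrable_smul v)).symm
  have hi : ∀ k, Integrable (fun x => φ x k * v x k) (volume.restrict Ω) := fun k =>
    (EuclideanSpace.proj (𝕜 := ℝ) k).integrable_comp ((hφ.coord k).integrable_smul v)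
  simp_rw [hk]
  rw [← integral_finsetSum _ fun k _ => hi k, L2.inner_def]
  refine integral_congr_ae ?_
  filter_upwards [hf] with x hx
  rw [hx, PiLp.inner_apply]
  simp

/-- Green's formula against test functions. -/
theorem sum_inner_grad_testGraph {u w : L2 Ω d} {g : Fin n → L2 Ω d} (hg : IsWeakGrad Ω u g)
    (hw : IsWeakLaplacian Ω u w) {p : L2 Ω d × (Fin n → L2 Ω d)} (hp : p ∈ testGraph Ω d) :
    ∑ i, inner ℝ (g i) (p.2 i) = - inner ℝ w p.1 := by
  obtain ⟨φ, hφ, h1, h2⟩ := hp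
  rw [inner_test_eq_sum hφ h1, Finset.sum_congr rfl fun i _ =>
    inner_test_eq_sum (hφ.pderiv i) (h2 i) (g i), Finset.sum_comm, ← Finset.sum_neg_distrib]
  refine Finset.sum_congr rfl fun k _ => ?_
  have hψ := hφ.coord k
  -- Test the weak gradient with `∂ᵢφₖ` and sum over `i`: this assembles `Δφₖ` against `u`. Only
  -- component `k` of this vector identity is used.
  have e : ∑ i, ∫ x in Ω, pderiv i φ x k • g i x = - ∫ x in Ω, φ x k • w x := by
    rw [← hw _ hψ]
    simp_rw [Finset.sum_smul]
    rw [integral_finsetSum _ fun i _ => ((hψ.pderiv i).pderiv i).integrable_smul u,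
      ← Finset.sum_neg_distrib]
    refine Finset.sum_congr rfl fun i _ => ?_
    rw [hg _ (hψ.pderiv i) i, neg_neg, pderiv_coord hφ]
  have := congrArg (fun y : EuclideanSpace ℝ (Fin d) => y k) e
  simpa using this

/-- Green's formula against `H¹₀` functions. -/
theorem sum_inner_grad_closure {u w : L2 Ω d} {g : Fin n → L2 Ω d} (hg : IsWeakGrad Ω u g)
    (hw : IsWeakLaplacian Ω u w) {p : L2 Ω d × (Fin n → L2 Ω d)}
    (hp : p ∈ closure (testGraph Ω d)) :
    ∑ i, inner ℝ (g i) (p.2 i) = - inner ℝ w p.1 := by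
  have hcl : IsClosed {p : L2 Ω d × (Fin n → L2 Ω d) |
      ∑ i, inner ℝ (g i) (p.2 i) = - inner ℝ w p.1} :=
    isClosed_eq (by fun_prop) (by fun_prop)
  exact closure_minimal (fun p hp => sum_inner_grad_testGraph hg hw hp) hcl hp

theorem isFiltered_sub_laplacian (hΩ : IsOpen Ω) (δ : ℝ) {u w : L2 Ω d} (hu : MemH10 Ω u)
    (hw : IsWeakLaplacian Ω u w) : IsFiltered Ω δ (u - δ ^ 2 • w) u := by
  obtain ⟨g, hg, -⟩ := id hu
  refine ⟨hu, g, hg, ?_⟩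
  rintro v h ⟨h', hh', hcl⟩ hh
  -- The given gradient is the limit of test gradients, so Green's formula applies to it.
  obtain rfl : h = h' := hh.unique hΩ hh'
  rw [sum_inner_grad_closure hg hw hcl, inner_sub_left, real_inner_smul_left]
  ring

/-- By well-posedness `u = G(u - δ²w)`; linearity of `G` does the rest. -/
theorem helmholtzFilter_laplacian (hΩ : IsOpen Ω) {δ : ℝ} (hδ : 0 < δ) {u w : L2 Ω d}
    (hu : MemH10 Ω u) (hw : IsWeakLaplacian Ω u w) :
    u - helmholtzFilter hΩ d hδ u = -(δ ^ 2) • helmholtzFilter hΩ d hδ w := by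
  have h := (isFiltered_sub_laplacian hΩ δ hu hw).unique
    (helmholtzFilter_spec hΩ d hδ (u - δ ^ 2 • w))
  rw [map_sub, map_smul] at h
  nth_rewrite 1 [h]
  rw [neg_smul]
  abel

/-- Test the weak equation with `Gf` itself and drop the gradient term. -/
theorem helmholtzFilter_firmly_nonexpansive (hΩ : IsOpen Ω) {δ : ℝ} (hδ : 0 < δ) (f : L2 Ω d) :
    ‖helmholtzFilter hΩ d hδ f‖ ^ 2 ≤ inner ℝ f (helmholtzFilter hΩ d hδ f) := by
  obtain ⟨hm, g, hg, e⟩ := helmholtzFilter_spec hΩ d hδ f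
  rw [← e _ _ hm hg, real_inner_self_eq_norm_sq]
  exact le_add_of_nonneg_left
    (mul_nonneg (sq_nonneg δ) (Finset.sum_nonneg fun i _ => real_inner_self_nonneg))

end WeakLaplacian

/-! ### Bounds for the regularized operator and the error recursion. -/

section Regularization

variable {n d : ℕ} {Ω : Set (EuclideanSpace ℝ (Fin n))} {G : L2 Ω d →L[ℝ] L2 Ω d} {α : ℝ}

theorem mitlarOp_apply (α : ℝ) (G : L2 Ω d →L[ℝ] L2 Ω d) (x : L2 Ω d) :
    mitlarOp α G x = (1 - α) • G x + α • x := rfl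

theorem inner_mitlarOp_self (x : L2 Ω d) :
    inner ℝ (mitlarOp α G x) x = (1 - α) * inner ℝ x (G x) + α * ‖x‖ ^ 2 := by
  rw [mitlarOp_apply, inner_add_left, real_inner_smul_left, real_inner_smul_left,
    real_inner_self_eq_norm_sq, real_inner_comm]

/-- Coercivity with constant `min α 1`: as `0 ≤ (x, Gx) ≤ ‖x‖²`, the lower bound serves `α ≤ 1` and
the upper bound `α ≥ 1`, where `1-α` is not positive. -/
theorem isUnit_mitlarOp (hG : ∀ x, ‖G x‖ ^ 2 ≤ inner ℝ x (G x)) (hα : 0 < α) :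
    IsUnit (mitlarOp α G) := by
  have hc : 0 < min α 1 := lt_min hα one_pos
  refine ContinuousLinearMap.isUnit_of_forall_le_norm_inner_map _ (c := ⟨min α 1, hc.le⟩) hc
    fun x => ?_
  rw [inner_mitlarOp_self]
  refine le_trans ?_ (le_abs_self _)
  change ‖x‖ ^ 2 * min α 1 ≤ _
  have h0 : 0 ≤ inner ℝ x (G x) := (sq_nonneg _).trans (hG x)
  have h1 : inner ℝ x (G x) ≤ ‖x‖ ^ 2 := by
    nlinarith [hG x, real_inner_le_norm x (G x), sq_nonneg (‖x‖ - ‖G x‖)]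
  rcases le_total α 1 with h | h
  · rw [min_eq_left h]
    nlinarith
  · rw [min_eq_right h]
    nlinarith

/-- The source of `‖D‖ ≤ 1/α`. Here `α ≤ 1` keeps `(1-α)(x, Gx)` nonnegative. -/
theorem norm_le_norm_mitlarOp (hG : ∀ x, ‖G x‖ ^ 2 ≤ inner ℝ x (G x)) (hα1 : α ≤ 1)
    (x : L2 Ω d) : α * ‖x‖ ≤ ‖mitlarOp α G x‖ := by
  have h0 : 0 ≤ inner ℝ x (G x) := (sq_nonneg _).trans (hG x)
  have h := real_inner_le_norm (mitlarOp α G x) x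
  rw [inner_mitlarOp_self] at h
  rcases (norm_nonneg x).eq_or_lt with hx | hx
  · rw [← hx, mul_zero]
    exact norm_nonneg _
  · refine le_of_mul_le_mul_right ?_ hx
    nlinarith

/-- Expands `A = G + α(I-G)`; firm nonexpansiveness makes the cross term nonnegative, so either
square may be dropped. -/
theorem norm_sq_mitlarOp (x : L2 Ω d) :
    ‖mitlarOp α G x‖ ^ 2 = ‖G x‖ ^ 2 + 2 * (α * (inner ℝ x (G x) - ‖G x‖ ^ 2))
      + ‖α • (x - G x)‖ ^ 2 := by
  have : mitlarOp α G x = G x + α • (x - G x) := by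
    rw [mitlarOp_apply]
    module
  rw [this, norm_add_sq_real, real_inner_smul_right, inner_sub_right, real_inner_self_eq_norm_sq,
    real_inner_comm]

theorem norm_filter_le_norm_mitlarOp (hG : ∀ x, ‖G x‖ ^ 2 ≤ inner ℝ x (G x)) (hα : 0 < α)
    (x : L2 Ω d) : ‖G x‖ ≤ ‖mitlarOp α G x‖ := by
  refine le_of_sq_le_sq ?_ (norm_nonneg _)
  rw [norm_sq_mitlarOp]
  have := mul_nonneg hα.le (sub_nonneg.2 (hG x))
  linarith [sq_nonneg ‖α • (x - G x)‖]

theorem norm_smul_sub_filter_le_norm_mitlarOp (hG : ∀ x, ‖G x‖ ^ 2 ≤ inner ℝ x (G x))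
    (hα : 0 < α) (x : L2 Ω d) : ‖α • (x - G x)‖ ≤ ‖mitlarOp α G x‖ := by
  refine le_of_sq_le_sq ?_ (norm_nonneg _)
  rw [norm_sq_mitlarOp]
  have := mul_nonneg hα.le (sub_nonneg.2 (hG x))
  linarith [sq_nonneg ‖G x‖]

theorem mitlarOp_mul_regInv (h : IsUnit (mitlarOp α G)) : mitlarOp α G * regInv α G = 1 :=
  Ring.mul_inverse_cancel _ h

theorem regInv_mul_mitlarOp (h : IsUnit (mitlarOp α G)) : regInv α G * mitlarOp α G = 1 :=
  Ring.inverse_mul_cancel _ h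

theorem commute_regInv (h : IsUnit (mitlarOp α G)) : Commute (regInv α G) G := by
  have hc : Commute (mitlarOp α G) G :=
    ((Commute.refl G).smul_left (1 - α)).add_left ((Commute.one_left G).smul_left α)
  obtain ⟨a, ha⟩ := h
  rw [regInv, ← ha, Ring.inverse_unit]
  rw [← ha] at hc
  exact hc.units_inv_left

/-- Multiply `A - G = α(I-G)` by `D` on the left. -/
theorem one_sub_regInv_mul (h : IsUnit (mitlarOp α G)) :
    1 - regInv α G * G = α • (regInv α G * (1 - G)) := by
  have e : mitlarOp α G - G = α • (1 - G) := by
    ext1 x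
    simp only [mitlarOp_apply, sub_apply, smul_apply,
      one_apply_eq_self]
    module
  rw [← mul_smul_comm, ← e, mul_sub, regInv_mul_mitlarOp h]

/-- The error of the iteration, before the Laplacian is used. -/
theorem IsMitlar.sub_eq (h : IsUnit (mitlarOp α G)) {J : ℕ} {u ubar ε : L2 Ω d}
    {U : ℕ → L2 Ω d} (hU : IsMitlar α G J ubar U) (hnoisy : G u = ubar + ε) {j : ℕ}
    (hj : j ≤ J) :
    u - U j = ((1 - regInv α G * G) ^ (j + 1)) u
      + regInv α G (∑ i ∈ Finset.range (j + 1), ((1 - regInv α G * G) ^ i) ε) := by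
  set D := regInv α G with hD
  have hDA : ∀ x, D (mitlarOp α G x) = x := fun x =>
    DFunLike.congr_fun (regInv_mul_mitlarOp h) x
  have hcomm : ∀ x, (1 - D * G) (D x) = D ((1 - D * G) x) := by
    have hc : Commute (1 - D * G) D :=
      (Commute.one_left D).sub_left ((Commute.refl D).mul_left (commute_regInv h).symm)
    exact fun x => DFunLike.congr_fun hc.eq x
  have hubar : ubar = G u - ε := eq_sub_of_add_eq hnoisy.symm
  induction j with
  | zero =>
    have e : U 0 = D (G u) - D ε := by
      rw [← map_sub, ← hubar, ← hU.init, hDA]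
    simp only [zero_add, pow_one, Finset.range_one, Finset.sum_singleton, pow_zero, e,
      sub_apply, one_apply_eq_self, mul_apply_eq_comp]
    abel
  | succ j ih =>
    have e : U (j + 1) - U j = D (G u) - D ε - D (G (U j)) := by
      have := congrArg D (hU.step (j + 1) (by omega) hj)
      rwa [hDA, Nat.add_sub_cancel, map_sub, hubar, map_sub] at this
    -- The error recursion.
    have e' : u - U (j + 1) = (1 - D * G) (u - U j) + D ε := by
      rw [← sub_sub_sub_cancel_right u (U (j + 1)) (U j), e]
      simp only [sub_apply, one_apply_eq_self,
        mul_apply_eq_comp, map_sub]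
      abel
    -- The sum is split at `i = 0`: that term is the new `Dε`, the others are the old ones shifted
    -- by one power.
    rw [e', ih (by omega), map_add, hcomm, map_sum, Finset.sum_range_succ' _ (j + 1), map_add,
      add_assoc, pow_succ' _ (j + 1)]
    simp only [pow_succ' _, pow_zero, mul_apply_eq_comp,
      one_apply_eq_self]

end Regularization

/-! ### Trading powers of `I-DG` for Laplacians, and the error estimate. -/

theorem one_sub_regInv_mul_pow_apply {n d : ℕ} {Ω : Set (EuclideanSpace ℝ (Fin n))}
    (hΩ : IsOpen Ω) {δ α : ℝ} (hδ : 0 < δ) (h : IsUnit (mitlarOp α (helmholtzFilter hΩ d hδ)))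
    {u : L2 Ω d} {m : ℕ} {L : ℕ → L2 Ω d} (hL : IsLaplacianChain Ω u m L) {j : ℕ} (hj : j ≤ m) :
    ((1 - regInv α (helmholtzFilter hΩ d hδ) * helmholtzFilter hΩ d hδ) ^ j) u
      = (-(α * δ ^ 2)) ^ j •
        ((regInv α (helmholtzFilter hΩ d hδ) * helmholtzFilter hΩ d hδ) ^ j) (L j) := by
  set G := helmholtzFilter hΩ d hδ with hG
  set D := regInv α G with hD
  induction j with
  | zero => simp [hL.zero]
  | succ j ih =>
    -- The boundary condition on `Δʲu` enters here; the new factor `I-DG` reaches `L j` by commuting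
    -- past `(DG)ʲ`.
    have e : (1 - D * G) (L j) = (-(α * δ ^ 2)) • (D * G) (L (j + 1)) := by
      rw [hD, one_sub_regInv_mul h, smul_apply, mul_apply_eq_comp,
        sub_apply, one_apply_eq_self, hG,
        helmholtzFilter_laplacian hΩ hδ (hL.memH10 j hj) (hL.succ j hj), map_smul, smul_smul,
        mul_neg]
      rfl
    have hc : Commute (1 - D * G) ((D * G) ^ j) :=
      ((Commute.one_left _).sub_left (Commute.refl _)).pow_right j
    rw [pow_succ' _ j, mul_apply_eq_comp, ih (by omega), map_smul,
      ← mul_apply_eq_comp, hc.eq, mul_apply_eq_comp, e, map_smul,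
      smul_smul, ← pow_succ, pow_succ (D * G)]
    rfl

theorem norm_pow_apply_le {E : Type*} [NormedAddCommGroup E] [NormedSpace ℝ E] {T : E →L[ℝ] E}
    (hT : ∀ x, ‖T x‖ ≤ ‖x‖) (j : ℕ) (x : E) : ‖(T ^ j) x‖ ≤ ‖x‖ := by
  induction j with
  | zero => simp
  | succ j ih =>
    rw [pow_succ', mul_apply_eq_comp]
    exact (hT _).trans ih

end Mitlar

theorem mainTheorem1 {n d : ℕ} {Ω : Set (EuclideanSpace ℝ (Fin n))} (hΩ : IsOpen Ω)
    {δ α ε₀ : ℝ} (hδ : 0 < δ) (hα : 0 < α) (J : ℕ)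
    (G : Mitlar.L2 Ω d →L[ℝ] Mitlar.L2 Ω d) (hG : G = Mitlar.helmholtzFilter hΩ d hδ)
    (D : Mitlar.L2 Ω d →L[ℝ] Mitlar.L2 Ω d) (hD : D = Mitlar.regInv α G)
    (u ubar ε : Mitlar.L2 Ω d) (hnoisy : G u = ubar + ε) (hε : ‖ε‖ < ε₀)
    (Lap : ℕ → Mitlar.L2 Ω d) (hLap : Mitlar.IsLaplacianChain Ω u (J + 1) Lap) :
    IsUnit (Mitlar.mitlarOp α G) ∧
      ∀ U : ℕ → Mitlar.L2 Ω d, Mitlar.IsMitlar α G J ubar U →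
        u - U J = (-(α * δ ^ 2)) ^ (J + 1) • ((D * G) ^ (J + 1)) (Lap (J + 1))
            + D (∑ j ∈ Finset.range (J + 1), ((1 - D * G) ^ j) ε) ∧
        (α ≤ 1 →
          ‖u - U J‖ ≤ (α * δ ^ 2) ^ (J + 1) * ‖Lap (J + 1)‖ + (J + 1) * ε₀ / α) := by
  have hfne : ∀ x, ‖G x‖ ^ 2 ≤ inner ℝ x (G x) := by
    rw [hG]
    exact Mitlar.helmholtzFilter_firmly_nonexpansive hΩ hδ
  have hunit : IsUnit (Mitlar.mitlarOp α G) := Mitlar.isUnit_mitlarOp hfne hα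
  have hAD : ∀ x, Mitlar.mitlarOp α G (D x) = x := fun x => by
    rw [hD]
    exact DFunLike.congr_fun (Mitlar.mitlarOp_mul_regInv hunit) x
  have hcomm : Commute D G := hD ▸ Mitlar.commute_regInv hunit
  -- As `DG = GD`, put `Dx` into `‖G·‖ ≤ ‖A·‖` and use `AD = 1`; the bound for `I-DG` is obtained
  -- likewise.
  have hDG : ∀ x, ‖(D * G) x‖ ≤ ‖x‖ := fun x => by
    rw [hcomm.eq]
    exact (Mitlar.norm_filter_le_norm_mitlarOp hfne hα (D x)).trans_eq (by rw [hAD])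
  have hIDG : ∀ x, ‖(1 - D * G) x‖ ≤ ‖x‖ := fun x => by
    have e : (1 - D * G) x = α • (D x - G (D x)) := by
      have hDsub : D * (1 - G) = (1 - G) * D := by
        rw [mul_sub, sub_mul, hcomm.eq, one_mul, mul_one]
      rw [hD, Mitlar.one_sub_regInv_mul hunit, ← hD, hDsub]
      rfl
    rw [e]
    exact (Mitlar.norm_smul_sub_filter_le_norm_mitlarOp hfne hα (D x)).trans_eq (by rw [hAD])
  refine ⟨hunit, fun U hU => ?_⟩
  have herr : u - U J = (-(α * δ ^ 2)) ^ (J + 1) • ((D * G) ^ (J + 1)) (Lap (J + 1))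
      + D (∑ j ∈ Finset.range (J + 1), ((1 - D * G) ^ j) ε) := by
    rw [hU.sub_eq hunit hnoisy le_rfl, hD]
    subst hG
    rw [Mitlar.one_sub_regInv_mul_pow_apply hΩ hδ hunit hLap le_rfl]
  refine ⟨herr, fun hα1 => ?_⟩
  rw [herr]
  refine (norm_add_le _ _).trans (add_le_add ?_ ?_)
  · rw [norm_smul, norm_pow, norm_neg, Real.norm_of_nonneg (by positivity)]
    exact mul_le_mul_of_nonneg_left (Mitlar.norm_pow_apply_le hDG _ _) (by positivity)
  · have hsum : ‖∑ j ∈ Finset.range (J + 1), ((1 - D * G) ^ j) ε‖ ≤ (J + 1) * ε₀ := by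
      refine (norm_sum_le_of_le _ fun j _ =>
        (Mitlar.norm_pow_apply_le hIDG j ε).trans hε.le).trans_eq ?_
      simp
    -- With `y` the noise sum, `α‖Dy‖ ≤ ‖ADy‖ = ‖y‖`.
    rw [le_div_iff₀ hα, mul_comm]
    refine (Mitlar.norm_le_norm_mitlarOp hfne hα1 _).trans ?_
    rwa [hAD]
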